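/- \textbf{Conventions.} Rings are commutative and unital. For a ring $B$ write $Q(B)$ for its total quotient ring. For a $B$-module $M$ let $M_{\rm tor}$ be the submodule of elements killed by a non-zero-divisor of $B$; $M$ is \emph{torsion} if $M=M_{\rm tor}$. Let $\mathcal P_B(M)$ be the set of primes $\mathfrak p$ of $B$ of height one with $(M_{\rm tor})_{\mathfrak p}\neq 0$. A $B$-module is \emph{pseudo-null} if its localisation at every prime of height at most one vanishes; a \emph{pseudo-isomorphism} is a $B$-linear map with pseudo-null kernel and cokernel, and $M$ is pseudo-isomorphic to $M'$ if there is a pseudo-isomorphism $M\to M'$. A finitely generated $B$-module $M$ is \emph{amenable} if (P$_1$) for every prime $\mathfrak p$ that is maximal among the primes contained in $\bigcup_{\mathfrak q\in\mathcal P_B(M)}\mathfrak q$, the ideals of $B_{\mathfrak p}$ are linearly ordered by inclusion, and (P$_2$) $\mathcal P_B(M)$ is finite and consists of finitely generated primes. If $Q(B)$ is semisimple and $M$ is a finitely presented, amenable, torsion $B$-module, its \emph{characteristic ideal} is $$\mathrm{char}_B(M)=\prod_{\mathfrak p\in\mathcal P_B(M)}\mathfrak p^{\sum_{i} e_{\mathfrak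 p,i}},\qquad\text{for any pseudo-isomorphism } M\to\bigoplus_{\mathfrak p\in\mathcal P_B(M)}\bigoplus_{i=1}^{n_{\mathfrak p}} B/\mathfrak p^{e_{\mathfrak p,i}}.$$ \textbf{Setting.} Let $(A_n,\ \phi_n\colon A_n\to A_{n-1})_n$ be an inverse system of rings, indexed by the natural numbers, with all $\phi_n$ surjective. Let $A=\varprojlim_n A_n$, with projections $\phi_{\langle n\rangle}\colon A\to A_n$, and put $I_n=\ker\phi_{\langle n\rangle}$. For an $A$-module $M$ let $M_{(n)}=M/I_nM$, regarded as a module over $A/I_n\cong A_n$; $M$ is \emph{$I_\bullet$-complete} if the natural map $M\to\varprojlim_n M_{(n)}$ is bijective. Assume that $A$ is compact, i.e. that each $A_n$ is a compact Hausdorff topological ring and each $\phi_n$ is continuous. \textbf{Proposition.} Let $M$ be a finitely presented $A$-module. (i) $M$ is $I_\bullet$-complete. (ii) If $Q(A)$ is semisimple and $M$ is an amenable torsion module, then $\mathrm{char}_A(M)$ is well defined (the above pseudo-isomorphisms exist and all give the same ideal), and $$\mathrm{char}_A(M)=\varprojlim_n\phi_{\langle n\rangle}(\mathrm{char}_A(M)),$$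 that is, an element $a\in A$ lies in $\mathrm{char}_A(M)$ if and only if $\phi_{\langle n\rangle}(a)\in\phi_{\langle n\rangle}(\mathrm{char}_A(M))$ for all $n$. (iii) Assume that $A$ and all $A_n$ are unique factorisation domains and that $M$ is torsion. Then $M$ is amenable, $\mathrm{char}_A(M)$ is well defined, and $M$ is pseudo-isomorphic to a finitely presented torsion $A$-module $\widetilde M$ that is $I_\bullet$-complete and for which there is an $N$ such that: for all $n\ge N$ the $A_n$-module $\widetilde M_{(n)}$ is finitely presented, torsion and amenable, $\mathrm{char}_{A_n}(\widetilde M_{(n)})$ is well defined, and $\phi_{n+1}$ maps $\mathrm{char}_{A_{n+1}}(\widetilde M_{(n+1)})$ into $\mathrm{char}_{A_n}(\widetilde M_{(n)})$; and $$\mathrm{char}_A(M)=\varprojlim_{n\ge N}\mathrm{char}_{A_n}(\widetilde M_{(n)}),$$ that is, an element $a\in A$ lies in $\mathrm{char}_A(M)$ if and only if $\phi_{\langle n\rangle}(a)\in\mathrm{char}_{A_n}(\widetilde M_{(n)})$ for all $n\ge N$. -/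

import Mathlib

open scoped DirectSum nonZeroDivisors

universe u v

noncomputable section

section ModuleNotions

variable (A : Type u) [CommRing A] (M : Type v) [AddCommGroup M] [Module A M]

/-- `𝒫_A(M)`: the primes of height one in the support of the torsion submodule of `M`. -/
def torsionHeightOnePrimes : Set (PrimeSpectrum A) :=
  {p | p.asIdeal.height = 1} ∩ Module.support A (Submodule.torsion A M)

/-- All localisations at primes of height at most one vanish. -/
def IsPseudoNull : Prop :=
  ∀ p : PrimeSpectrum A, p.asIdeal.height ≤ 1 →
    Subsingleton (LocalizedModule p.asIdeal.primeCompl M)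

/-- The localisation `A_𝔭` is a valuation ring: its ideals are linearly ordered by inclusion. -/
def IsValuationAt (p : PrimeSpectrum A) : Prop :=
  ∀ I J : Ideal (Localization.AtPrime p.asIdeal), I ≤ J ∨ J ≤ I

/-- Amenable modules. -/
structure IsAmenableModule : Prop where
  finite : Module.Finite A M
  valuation : ∀ p : PrimeSpectrum A,
    Maximal (fun p' : PrimeSpectrum A =>
      (p'.asIdeal : Set A) ⊆ ⋃ q ∈ torsionHeightOnePrimes A M, (q.asIdeal : Set A)) p →
    IsValuationAt A p
  finite_primes : (torsionHeightOnePrimes A M).Finite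
  fg_primes : ∀ q ∈ torsionHeightOnePrimes A M, q.asIdeal.FG

variable {A M} in
/-- A linear map whose kernel and cokernel are pseudo-null. -/
def IsPseudoIso {N : Type*} [AddCommGroup N] [Module A N] (f : M →ₗ[A] N) : Prop :=
  IsPseudoNull A (LinearMap.ker f) ∧ IsPseudoNull A (N ⧸ LinearMap.range f)

/-- The module `⨁_𝔭 ⨁ᵢ A / 𝔭 ^ e_{𝔭,i}`, with `𝔭` running over `𝒫_A(M)`. -/
def PrimePowerSum (k : torsionHeightOnePrimes A M → ℕ)
    (e : ∀ p : torsionHeightOnePrimes A M, Fin (k p) → ℕ) : Type u :=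
  ⨁ p : torsionHeightOnePrimes A M, ⨁ i : Fin (k p), A ⧸ (p.1.asIdeal ^ e p i)

instance (k : torsionHeightOnePrimes A M → ℕ)
    (e : ∀ p : torsionHeightOnePrimes A M, Fin (k p) → ℕ) :
    AddCommGroup (PrimePowerSum A M k e) :=
  inferInstanceAs (AddCommGroup
    (⨁ p : torsionHeightOnePrimes A M, ⨁ i : Fin (k p), A ⧸ (p.1.asIdeal ^ e p i)))

instance (k : torsionHeightOnePrimes A M → ℕ)
    (e : ∀ p : torsionHeightOnePrimes A M, Fin (k p) → ℕ) :
    Module A (PrimePowerSum A M k e) :=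
  inferInstanceAs (Module A
    (⨁ p : torsionHeightOnePrimes A M, ⨁ i : Fin (k p), A ⧸ (p.1.asIdeal ^ e p i)))

/-- `J` arises as `∏_𝔭 𝔭 ^ (∑ᵢ e_{𝔭,i})` from a pseudo-isomorphism
`M → ⨁_𝔭 ⨁ᵢ A / 𝔭 ^ e_{𝔭,i}`, with `𝔭` running over `𝒫_A(M)`. -/
def IsCharIdeal (J : Ideal A) : Prop :=
  ∃ (k : torsionHeightOnePrimes A M → ℕ)
    (e : ∀ p : torsionHeightOnePrimes A M, Fin (k p) → ℕ)
    (f : M →ₗ[A] PrimePowerSum A M k e),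
    IsPseudoIso f ∧
      J = ∏ᶠ p : torsionHeightOnePrimes A M, p.1.asIdeal ^ (∑ i, e p i)

open Classical in
/-- The characteristic ideal, computed from a chosen pseudo-isomorphism
(and the unit ideal if there is none). -/
def charIdeal : Ideal A :=
  if h : ∃ J, IsCharIdeal A M J then h.choose else ⊤

end ModuleNotions

/-- Inverse systems `⋯ → A₂ → A₁ → A₀` of commutative rings with surjective transition maps. -/
structure RingTower where
  obj : ℕ → Type u
  [commRing : ∀ n, CommRing (obj n)]
  map : ∀ n, obj (n + 1) →+* obj n
  map_surjective : ∀ n, Function.Surjective (map n)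

namespace RingTower

attribute [instance] RingTower.commRing

variable (S : RingTower.{u})

/-- Compatible sequences, as a subring of the product. -/
def limSubring : Subring (∀ n, S.obj n) where
  carrier := {x | ∀ n, S.map n (x (n + 1)) = x n}
  mul_mem' hx hy n := by simp [hx n, hy n]
  one_mem' n := by simp
  add_mem' hx hy n := by simp [hx n, hy n]
  zero_mem' n := by simp
  neg_mem' hx n := by simp [hx n]

/-- The inverse limit ring `A`. -/
abbrev Lim : Type u := S.limSubring

/-- The projection `A → A_n`. -/
def proj (n : ℕ) : S.Lim →+* S.obj n :=
  (Pi.evalRingHom S.obj n).comp S.limSubring.subtype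

theorem map_proj (n : ℕ) (x : S.Lim) : S.map n (S.proj (n + 1) x) = S.proj n x :=
  x.2 n

theorem proj_surjective (n : ℕ) : Function.Surjective (S.proj n) := by
  have key : ∀ (n : ℕ) (S : RingTower.{u}) (a : S.obj n),
      ∃ x : ∀ m, S.obj m, (∀ m, S.map m (x (m + 1)) = x m) ∧ x n = a := by
    intro n
    induction n with
    | zero =>
      intro S a
      choose g hg using S.map_surjective
      exact ⟨fun m => Nat.rec a (fun k y => g k y) m, fun m => hg m _, rfl⟩
    | succ n ih =>
      intro S a
      obtain ⟨x, hx, hxa⟩ := ih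
        ⟨fun m => S.obj (m + 1), fun m => S.map (m + 1), fun m => S.map_surjective (m + 1)⟩ a
      refine ⟨fun m => Nat.casesOn m (S.map 0 (x 0)) x, ?_, hxa⟩
      intro m
      cases m with
      | zero => rfl
      | succ m => exact hx m
  intro a
  obtain ⟨x, hx, hxa⟩ := key n S a
  exact ⟨⟨x, hx⟩, hxa⟩

/-- `I_n`, the kernel of `A → A_n`. -/
abbrev kerIdeal (n : ℕ) : Ideal S.Lim := RingHom.ker (S.proj n)

theorem kerIdeal_succ_le (n : ℕ) : S.kerIdeal (n + 1) ≤ S.kerIdeal n := by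
  intro x hx
  have hx' : S.proj (n + 1) x = 0 := hx
  change S.proj n x = 0
  rw [← S.map_proj, hx', map_zero]

/-- The isomorphism `A_n ≃ A / I_n` induced by the projection. -/
def objEquiv (n : ℕ) : S.obj n ≃+* S.Lim ⧸ S.kerIdeal n :=
  (RingHom.quotientKerEquivOfSurjective (S.proj_surjective n)).symm

theorem objEquiv_proj (n : ℕ) (a : S.Lim) :
    S.objEquiv n (S.proj n a) = Ideal.Quotient.mk (S.kerIdeal n) a := by
  unfold objEquiv
  rw [RingEquiv.symm_apply_eq]
  rfl

section Level

variable (M : Type v) [AddCommGroup M] [Module S.Lim M]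

/-- `M_(n) = M / I_n M`. -/
def Level (n : ℕ) : Type v := M ⧸ (S.kerIdeal n • (⊤ : Submodule S.Lim M))

instance (n : ℕ) : AddCommGroup (S.Level M n) :=
  inferInstanceAs (AddCommGroup (M ⧸ (S.kerIdeal n • (⊤ : Submodule S.Lim M))))

instance (n : ℕ) : Module S.Lim (S.Level M n) :=
  inferInstanceAs (Module S.Lim (M ⧸ (S.kerIdeal n • (⊤ : Submodule S.Lim M))))

/-- The quotient map `M → M_(n)`. -/
def toLevel (n : ℕ) : M →ₗ[S.Lim] S.Level M n :=
  (S.kerIdeal n • (⊤ : Submodule S.Lim M)).mkQ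

/-- `M_(n)` as an `A / I_n`-module. -/
instance (n : ℕ) : Module (S.Lim ⧸ S.kerIdeal n) (S.Level M n) :=
  inferInstanceAs (Module (S.Lim ⧸ S.kerIdeal n)
    (M ⧸ (S.kerIdeal n • (⊤ : Submodule S.Lim M))))

/-- `M_(n)` as an `A_n`-module, through `A_n ≃ A / I_n`. -/
instance (n : ℕ) : Module (S.obj n) (S.Level M n) :=
  Module.compHom (S.Level M n) (S.objEquiv n).toRingHom

/-- The `A_n`-module structure on `M_(n)` is compatible with its `A`-module structure. -/
theorem proj_smul (n : ℕ) (a : S.Lim) (x : S.Level M n) : S.proj n a • x = a • x := by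
  have h : S.proj n a • x = S.objEquiv n (S.proj n a) • x := rfl
  rw [h, S.objEquiv_proj]
  obtain ⟨m, rfl⟩ := Submodule.mkQ_surjective _ x
  rfl

/-- The transition map `M_(n+1) → M_(n)`. -/
def levelMap (n : ℕ) : S.Level M (n + 1) →ₗ[S.Lim] S.Level M n :=
  Submodule.factor (Submodule.smul_mono_left (S.kerIdeal_succ_le n))

/-- The inverse limit of the modules `M_(n)`. -/
def levelLim : Submodule S.Lim (∀ n, S.Level M n) where
  carrier := {x | ∀ n, S.levelMap M n (x (n + 1)) = x n}
  add_mem' hx hy n := by simp [hx n, hy n]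
  zero_mem' n := by simp
  smul_mem' a x hx n := by simp [hx n]

/-- The natural map `M → lim M_(n)`. -/
def toLevelLim : M →ₗ[S.Lim] S.levelLim M :=
  (LinearMap.pi (S.toLevel M)).codRestrict (S.levelLim M) fun _ _ => rfl

/-- `M` is `I_•`-complete. -/
def IsLevelComplete : Prop := Function.Bijective (S.toLevelLim M)

end Level

/-- The inverse limit of ideals `J_n` of `A_n`, over `n ≥ N`, inside `A`: the elements of `A`
whose image in `A_n` lies in `J_n` for every `n ≥ N`. -/
def limIdeal (N : ℕ) (J : ∀ n, Ideal (S.obj n)) : Ideal S.Lim :=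
  ⨅ (n : ℕ) (_ : N ≤ n), (J n).comap (S.proj n)

end RingTower

end

/-! Two independent mechanisms carry the result. Compactness: a finitely generated submodule of
`A^k` is a continuous image of some `A^m`, hence compact, and the nested sets cut out by the
congruences modulo `I_n` have a common point. Since the `I_n` intersect in zero, such a submodule is
closed for the `I_n`-topology (`mem_of_forall_mem_sup`). This gives completeness of finitely
presented modules (`isLevelComplete_of_surjective`) and shows that a finitely generated ideal is the
limit of its images (`eq_limIdeal_of_fg`). In the amenable case the characteristic ideal is a
product of powers of finitely generated primes, so the limit formula applies to it. Local lengths: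
amenability and reducedness make `A_p` a discrete valuation ring at every `p` in `𝒫_A(M)`. There
`M_p` is a finite sum of cyclic torsion modules, and finite presentation descends these
decompositions to one pseudo-isomorphism over `A` (`exists_isCharIdeal`). The exponent sum at `p`
must be the length of `M_p`, so the ideal depends on `M` alone (`IsCharIdeal.eq_finprod`). Over a
factorial domain the elementary module is a product of cyclic modules `A/(a_i)`, and it serves as
the replacement module. Comparing lengths shows that any torsion module pseudo-isomorphic to such a
product has characteristic ideal generated by `∏ a_i` (`IsCharIdeal.eq_span`). Reduction modulo
`I_n` replaces each `a_i` by its image, so once `∏ a_i` is nonzero in `A_n` the characteristic ideal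
at level `n` is the image of the one over `A`, and the limit formula finishes the argument. -/

noncomputable section

/-! ### Compactness: closed submodules, completeness, ideals as limits -/

namespace RingTower

open scoped Pointwise

variable (S : RingTower.{u})

theorem mem_kerIdeal_smul_top {k : ℕ} (I : Ideal S.Lim) (x : Fin k → S.Lim) :
    x ∈ I • (⊤ : Submodule S.Lim (Fin k → S.Lim)) ↔ ∀ i, x i ∈ I := by
  constructor
  · intro hx i
    have h : I • (⊤ : Submodule S.Lim (Fin k → S.Lim)) ≤
        Submodule.comap (LinearMap.proj i) I :=
      Submodule.smul_le.2 fun r hr n _ => I.mul_mem_right (n i) hr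
    exact h hx
  · intro hx
    rw [← Finset.univ_sum_single x]
    refine Submodule.sum_mem _ fun i _ => ?_
    have : (Pi.single i (x i) : Fin k → S.Lim) = x i • Pi.single i 1 := by
      rw [← Pi.single_smul, smul_eq_mul, mul_one]
    rw [this]
    exact Submodule.smul_mem_smul (hx i) trivial

theorem map_map_proj (J : Ideal S.Lim) (n : ℕ) :
    (J.map (S.proj (n + 1))).map (S.map n) = J.map (S.proj n) := by
  rw [Ideal.map_map]
  congr 1
  exact RingHom.ext fun x => S.map_proj n x

theorem ext_proj {x y : S.Lim} (h : ∀ n, S.proj n x = S.proj n y) : x = y :=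
  Subtype.ext (funext h)

variable [∀ n, TopologicalSpace (S.obj n)]

theorem continuous_proj (n : ℕ) : Continuous (S.proj n) :=
  (continuous_apply n).comp continuous_subtype_val

variable [∀ n, T2Space (S.obj n)]

theorem isClosed_kerIdeal (n : ℕ) : IsClosed (S.kerIdeal n : Set S.Lim) := by
  have : (S.kerIdeal n : Set S.Lim) = S.proj n ⁻¹' {0} := rfl
  rw [this]
  exact isClosed_singleton.preimage (S.continuous_proj n)

theorem isClosed_kerIdeal_smul_top (n k : ℕ) :
    IsClosed ((S.kerIdeal n • (⊤ : Submodule S.Lim (Fin k → S.Lim)) : Submodule _ _) :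
      Set (Fin k → S.Lim)) := by
  have : ((S.kerIdeal n • (⊤ : Submodule S.Lim (Fin k → S.Lim)) : Submodule _ _) :
      Set (Fin k → S.Lim)) = ⋂ i, (fun x => x i) ⁻¹' (S.kerIdeal n : Set S.Lim) := by
    ext x
    simp only [SetLike.mem_coe, mem_kerIdeal_smul_top, Set.mem_iInter, Set.mem_preimage]
  rw [this]
  exact isClosed_iInter fun i => (S.isClosed_kerIdeal n).preimage (continuous_apply i)

variable [∀ n, CompactSpace (S.obj n)]

theorem compactSpace_lim (hcont : ∀ n, Continuous (S.map n)) : CompactSpace S.Lim := by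
  refine isCompact_iff_compactSpace.1 
    (IsClosed.isCompact (X := ∀ n, S.obj n) (s := {x | ∀ n, S.map n (x (n + 1)) = x n}) ?_)
  rw [Set.ofPred_forall]
  exact isClosed_iInter fun n => isClosed_eq ((hcont n).comp (continuous_apply _))
    (continuous_apply n)

variable [∀ n, IsTopologicalRing (S.obj n)]

theorem isCompact_of_fg (hcont : ∀ n, Continuous (S.map n)) {k : ℕ}
    {R : Submodule S.Lim (Fin k → S.Lim)} (hR : R.FG) : IsCompact (R : Set (Fin k → S.Lim)) := by
  have := S.compactSpace_lim hcont
  obtain ⟨m, v, rfl⟩ := Submodule.fg_iff_exists_fin_generating_family.1 hR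
  rw [← Fintype.range_linearCombination, LinearMap.coe_range]
  refine isCompact_range ?_
  refine continuous_pi fun j => ?_
  have h : (fun c : Fin m → S.Lim => Fintype.linearCombination S.Lim v c j) =
      fun c => ∑ i, c i * v i j := by
    funext c
    simp [Fintype.linearCombination_apply]
  rw [h]
  exact continuous_finsetSum _ fun i _ => (continuous_apply i).mul continuous_const

/-- The elements `r` of `R` congruent to `x` modulo `I_n` form a decreasing sequence of nonempty
compact sets. A common element differs from `x` by something in every `I_n A^k`, hence equals `x`.
-/
theorem mem_of_forall_mem_sup (hcont : ∀ n, Continuous (S.map n)) {k : ℕ}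
    {R : Submodule S.Lim (Fin k → S.Lim)} (hR : R.FG) {x : Fin k → S.Lim}
    (hx : ∀ n, x ∈ R ⊔ S.kerIdeal n • ⊤) : x ∈ R := by
  have hc := S.isCompact_of_fg hcont hR
  let C : ℕ → Set (Fin k → S.Lim) := fun n =>
    (R : Set (Fin k → S.Lim)) ∩ (fun r => x - r) ⁻¹' (S.kerIdeal n • ⊤ : Submodule S.Lim (Fin k → S.Lim))
  have hcl : ∀ n, IsClosed (C n) := fun n =>
    hc.isClosed.inter ((S.isClosed_kerIdeal_smul_top n k).preimage (by fun_prop))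
  obtain ⟨r, hr⟩ := IsCompact.nonempty_iInter_of_sequence_nonempty_isCompact_isClosed C
    (fun n r hr => ⟨hr.1, Submodule.smul_mono_left (S.kerIdeal_succ_le n) hr.2⟩)
    (fun n => by
      obtain ⟨r, hr, y, hy, rfl⟩ := Submodule.mem_sup.1 (hx n)
      exact ⟨r, hr, by simpa using hy⟩)
    (hc.of_isClosed_subset (hcl 0) Set.inter_subset_left) hcl
  rw [Set.mem_iInter] at hr
  have : x = r := by
    funext i
    refine S.ext_proj fun n => ?_
    have := (mem_kerIdeal_smul_top S _ _).1 (hr n).2 i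
    exact sub_eq_zero.1 ((map_sub (S.proj n) (x i) (r i)).symm.trans this)
  rw [this]
  exact (hr 0).1

/-- Everything is pulled back to `A^k`, so `M` itself needs no topology. Injectivity is closedness
of `ker π`; surjectivity comes from intersecting the sets of lifts of the components of a compatible
family. -/
theorem isLevelComplete_of_surjective (hcont : ∀ n, Continuous (S.map n)) {M : Type v}
    [AddCommGroup M] [Module S.Lim M] {k : ℕ} (π : (Fin k → S.Lim) →ₗ[S.Lim] M)
    (hπ : Function.Surjective π) (hR : (LinearMap.ker π).FG) : S.IsLevelComplete M := by
  have key : ∀ n y, S.toLevel M n (π y) = 0 ↔ y ∈ LinearMap.ker π ⊔ S.kerIdeal n • ⊤ := by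
    intro n y
    have h1 : S.toLevel M n (π y) = 0 ↔ π y ∈ S.kerIdeal n • (⊤ : Submodule S.Lim M) :=
      Submodule.Quotient.mk_eq_zero _
    have h2 : S.kerIdeal n • (⊤ : Submodule S.Lim M) =
        (S.kerIdeal n • (⊤ : Submodule S.Lim (Fin k → S.Lim))).map π := by
      rw [Submodule.map_smul'', Submodule.map_top, LinearMap.range_eq_top.2 hπ]
    rw [h1, h2, ← Submodule.mem_comap, Submodule.comap_map_eq, sup_comm]
  have hc := S.isCompact_of_fg hcont hR
  have := S.compactSpace_lim hcont
  constructor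
  · rw [injective_iff_map_eq_zero]
    intro x hx
    obtain ⟨y, rfl⟩ := hπ x
    exact S.mem_of_forall_mem_sup hcont hR fun n => (key n y).1 (congrFun (congrArg Subtype.val hx) n)
  · rintro ⟨x, hx⟩
    let C : ℕ → Set (Fin k → S.Lim) := fun n => {y | S.toLevel M n (π y) = x n}
    have hne : ∀ n, (C n).Nonempty := by
      intro n
      obtain ⟨m, hm⟩ := Submodule.mkQ_surjective _ (x n)
      obtain ⟨y, rfl⟩ := hπ m
      exact ⟨y, hm⟩
    have hcl : ∀ n, IsClosed (C n) := by
      intro n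
      obtain ⟨y₀, hy₀⟩ := hne n
      have hy₀' : S.toLevel M n (π y₀) = x n := hy₀
      -- The lifts of `x n` form a coset of `ker π + I_n A^k`, which is closed as a sum of two
      -- compact sets.
      have : C n = (fun y => y - y₀) ⁻¹' ((LinearMap.ker π : Set (Fin k → S.Lim)) +
          ((S.kerIdeal n • ⊤ : Submodule S.Lim (Fin k → S.Lim)) : Set (Fin k → S.Lim))) := by
        ext y
        rw [← Submodule.coe_sup, Set.mem_preimage, SetLike.mem_coe, ← key, map_sub, map_sub, hy₀',
          sub_eq_zero]
        rfl
      rw [this]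
      exact (hc.add (S.isClosed_kerIdeal_smul_top n k).isCompact).isClosed.preimage (by fun_prop)
    obtain ⟨y, hy⟩ := IsCompact.nonempty_iInter_of_sequence_nonempty_isCompact_isClosed C
      (fun n y hy => by
        have hy' : S.toLevel M (n + 1) (π y) = x (n + 1) := hy
        change S.toLevel M n (π y) = x n
        rw [← hx n, ← hy']
        rfl) hne (hcl 0).isCompact hcl
    rw [Set.mem_iInter] at hy
    exact ⟨π y, Subtype.ext (funext hy)⟩

theorem isLevelComplete (hcont : ∀ n, Continuous (S.map n)) (M : Type v)
    [AddCommGroup M] [Module S.Lim M] [Module.FinitePresentation S.Lim M] :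
    S.IsLevelComplete M := by
  obtain ⟨k, K, e, hK⟩ := Module.FinitePresentation.exists_fin S.Lim M
  refine S.isLevelComplete_of_surjective hcont (e.symm.toLinearMap ∘ₗ K.mkQ)
    (e.symm.surjective.comp K.mkQ_surjective) ?_
  rw [LinearEquiv.ker_comp, Submodule.ker_mkQ]
  exact hK

/-- Finitely generated ideals of a compact inverse limit are closed. -/
theorem mem_of_forall_proj_mem (hcont : ∀ n, Continuous (S.map n)) {J : Ideal S.Lim} (hJ : J.FG)
    {a : S.Lim} (ha : ∀ n, S.proj n a ∈ J.map (S.proj n)) : a ∈ J := by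
  let e : (Fin 1 → S.Lim) ≃ₗ[S.Lim] S.Lim := LinearEquiv.funUnique (Fin 1) S.Lim S.Lim
  have hfg : (Submodule.map e.symm.toLinearMap J).FG := Submodule.FG.map _ hJ
  have hmem : ∀ x, x ∈ Submodule.map e.symm.toLinearMap J ↔ x 0 ∈ J := fun x =>
    ⟨fun ⟨y, hy, h⟩ => h ▸ hy, fun h => ⟨x 0, h, e.symm_apply_apply x⟩⟩
  refine (hmem fun _ => a).1 (S.mem_of_forall_mem_sup hcont hfg fun n => ?_)
  obtain ⟨b, hb, hab⟩ := (Ideal.mem_map_iff_of_surjective _ (S.proj_surjective n)).1 (ha n)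
  refine Submodule.mem_sup.2 ⟨fun _ => b, (hmem _).2 hb, fun _ => a - b, ?_, ?_⟩
  · rw [mem_kerIdeal_smul_top]
    intro _
    rw [RingHom.mem_ker, map_sub, hab, sub_self]
  · funext i
    simp

theorem eq_limIdeal_of_fg (hcont : ∀ n, Continuous (S.map n)) {J : Ideal S.Lim} (hJ : J.FG)
    (N : ℕ) (K : ∀ n, Ideal (S.obj n)) (hK : ∀ n, N ≤ n → K n = J.map (S.proj n)) :
    J = S.limIdeal N K := by
  have hmono : ∀ (a : S.Lim) n, S.proj (n + 1) a ∈ J.map (S.proj (n + 1)) →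
      S.proj n a ∈ J.map (S.proj n) := by
    intro a n h
    rw [← S.map_map_proj, ← S.map_proj]
    exact Ideal.mem_map_of_mem _ h
  ext a
  simp only [limIdeal, Submodule.mem_iInf, Ideal.mem_comap]
  constructor
  · intro h n hn
    rw [hK n hn]
    exact Ideal.mem_map_of_mem _ h
  · intro h
    have h' : ∀ n, N ≤ n → S.proj n a ∈ J.map (S.proj n) := fun n hn => hK n hn ▸ h n hn
    -- Levels below `N` impose no further condition: membership at level `N` descends along the
    -- transition maps.
    refine S.mem_of_forall_proj_mem hcont hJ fun n => ?_
    obtain hn | hn := le_total N n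
    · exact h' n hn
    · exact Nat.decreasingInduction (motive := fun m _ => S.proj m a ∈ J.map (S.proj m))
        (fun m _ => hmono a m) (h' N le_rfl) hn

end RingTower

/-! ### Pseudo-isomorphisms prime by prime, and local lengths -/

section LocalEquiv

variable {A : Type u} [CommRing A] {M : Type*} [AddCommGroup M] [Module A M]
  {N : Type*} [AddCommGroup N] [Module A N]

/-- The localisation of the linear map `f` at the prime `p` is bijective. -/
def IsLocalEquiv (p : PrimeSpectrum A) (f : M →ₗ[A] N) : Prop :=
  (∀ x, f x = 0 → ∃ s ∈ p.asIdeal.primeCompl, s • x = 0) ∧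
    ∀ y, ∃ s ∈ p.asIdeal.primeCompl, ∃ x, f x = s • y

theorem isPseudoIso_iff (f : M →ₗ[A] N) :
    IsPseudoIso f ↔ ∀ p : PrimeSpectrum A, p.asIdeal.height ≤ 1 → IsLocalEquiv p f := by
  simp only [IsPseudoIso, IsPseudoNull, LocalizedModule.subsingleton_iff, IsLocalEquiv]
  rw [← forall_and]
  refine forall_congr' fun p => ?_
  rw [← imp_and]
  refine imp_congr_right fun _ => and_congr ?_ ?_
  · constructor
    · intro h x hx
      obtain ⟨s, hs, h'⟩ := h ⟨x, hx⟩
      exact ⟨s, hs, congrArg Subtype.val h'⟩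
    · rintro h ⟨x, hx⟩
      obtain ⟨s, hs, h'⟩ := h x hx
      exact ⟨s, hs, Subtype.ext h'⟩
  · have (s : A) (y : N) : s • (LinearMap.range f).mkQ y = 0 ↔ ∃ x, f x = s • y := by
      rw [← map_smul, Submodule.mkQ_apply, Submodule.Quotient.mk_eq_zero]
      rfl
    rw [(Submodule.mkQ_surjective _).forall]
    simp only [this]

theorem IsLocalEquiv.isLocalizedModule {p : PrimeSpectrum A} {f : M →ₗ[A] N}
    (hf : IsLocalEquiv p f) {X : Type*} [AddCommGroup X] [Module A X] (g : N →ₗ[A] X)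
    [IsLocalizedModule p.asIdeal.primeCompl g] :
    IsLocalizedModule p.asIdeal.primeCompl (g ∘ₗ f) where
  map_units := IsLocalizedModule.map_units g
  surj y := by
    obtain ⟨⟨n, s⟩, hn⟩ := IsLocalizedModule.surj p.asIdeal.primeCompl g y
    obtain ⟨t, ht, x, hx⟩ := hf.2 n
    refine ⟨⟨x, ⟨t, ht⟩ * s⟩, ?_⟩
    simp only [LinearMap.comp_apply, hx, map_smul, mul_smul, hn]
    rw [← hn]
    rfl
  exists_of_eq {x y} h := by
    obtain ⟨s, hs⟩ := IsLocalizedModule.exists_of_eq (S := p.asIdeal.primeCompl) (f := g) h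
    obtain ⟨t, ht, h'⟩ := hf.1 (s • (x - y)) (by
      rw [Submonoid.smul_def, map_smul, map_sub, smul_sub, sub_eq_zero]; exact hs)
    refine ⟨⟨t, ht⟩ * s, ?_⟩
    rw [mul_smul, mul_smul, ← sub_eq_zero, ← smul_sub, ← smul_sub]
    exact h'

/-- A local isomorphism lifts to a map over `A` only after multiplication by some `s` outside `p`.
This does no harm, because `s` acts invertibly on the localisation. -/
theorem IsLocalEquiv.of_comp_eq_smul {p : PrimeSpectrum A} {f : M →ₗ[A] N}
    {X : Type*} [AddCommGroup X] [Module A X] (g : N →ₗ[A] X)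
    [IsLocalizedModule p.asIdeal.primeCompl g] (h : M →ₗ[A] X)
    [IsLocalizedModule p.asIdeal.primeCompl h] (s : p.asIdeal.primeCompl)
    (hgf : g ∘ₗ f = s • h) : IsLocalEquiv p f := by
  have hgf' : ∀ x, g (f x) = h ((s : A) • x) := fun x => by
    rw [← LinearMap.comp_apply, hgf, map_smul]
    rfl
  constructor
  · intro x hx
    have : h ((s : A) • x) = h 0 := by rw [← hgf', hx, map_zero, map_zero]
    obtain ⟨t, ht⟩ := IsLocalizedModule.exists_of_eq (S := p.asIdeal.primeCompl) this
    exact ⟨t * s, mul_mem t.2 s.2, by rw [mul_smul]; exact ht.trans (smul_zero _)⟩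
  · intro y
    obtain ⟨⟨x, t⟩, hx⟩ := IsLocalizedModule.surj p.asIdeal.primeCompl h (g y)
    have : g ((s * t : A) • y) = g (f x) := by
      rw [hgf', map_smul, map_smul, mul_smul]
      exact congrArg ((s : A) • ·) hx
    obtain ⟨u, hu⟩ := IsLocalizedModule.exists_of_eq (S := p.asIdeal.primeCompl) this
    refine ⟨u * (s * t), mul_mem u.2 (mul_mem s.2 t.2), (u : A) • x, ?_⟩
    rw [map_smul, mul_smul]
    exact hu.symm

theorem IsLocalEquiv.of_forall_exists_smul_eq_zero {p : PrimeSpectrum A} (f : M →ₗ[A] N)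
    (hM : ∀ x : M, ∃ s ∈ p.asIdeal.primeCompl, s • x = 0)
    (hN : ∀ x : N, ∃ s ∈ p.asIdeal.primeCompl, s • x = 0) : IsLocalEquiv p f := by
  refine ⟨fun x _ => hM x, fun y => ?_⟩
  obtain ⟨s, hs, h⟩ := hN y
  exact ⟨s, hs, 0, by rw [h, map_zero]⟩

theorem IsLocalEquiv.linearEquiv_comp {p : PrimeSpectrum A} {f : M →ₗ[A] N}
    {N' : Type*} [AddCommGroup N'] [Module A N'] (e : N ≃ₗ[A] N') (h : IsLocalEquiv p f) :
    IsLocalEquiv p (e.toLinearMap ∘ₗ f) := by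
  refine ⟨fun x hx => h.1 x (by simpa using hx), fun y => ?_⟩
  obtain ⟨s, hs, x, hx⟩ := h.2 (e.symm y)
  exact ⟨s, hs, x, by simp [hx]⟩

variable (M) in
/-- The length of the localisation of `M` at the prime `p`. -/
def localLength (p : PrimeSpectrum A) : ℕ∞ :=
  Module.length (Localization p.asIdeal.primeCompl) (LocalizedModule p.asIdeal.primeCompl M)

theorem localLength_eq {p : PrimeSpectrum A} {X : Type*} [AddCommGroup X] [Module A X]
    [Module (Localization p.asIdeal.primeCompl) X]
    [IsScalarTower A (Localization p.asIdeal.primeCompl) X] (g : M →ₗ[A] X)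
    [IsLocalizedModule p.asIdeal.primeCompl g] :
    localLength M p = Module.length (Localization p.asIdeal.primeCompl) X :=
  ((IsLocalizedModule.iso p.asIdeal.primeCompl g).extendScalarsOfIsLocalization
    p.asIdeal.primeCompl (Localization p.asIdeal.primeCompl)).length_eq

theorem IsLocalEquiv.localLength_eq {p : PrimeSpectrum A} {f : M →ₗ[A] N}
    (hf : IsLocalEquiv p f) : localLength M p = localLength N p := by
  have := hf.isLocalizedModule (LocalizedModule.mkLinearMap p.asIdeal.primeCompl N)
  exact _root_.localLength_eq (LocalizedModule.mkLinearMap p.asIdeal.primeCompl N ∘ₗ f)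

theorem localLength_pi (p : PrimeSpectrum A) {ι : Type*} [Finite ι] (E : ι → Type*)
    [∀ i, AddCommGroup (E i)] [∀ i, Module A (E i)] :
    localLength (∀ i, E i) p = ∑ᶠ i, localLength (E i) p := by
  cases nonempty_fintype ι
  rw [localLength_eq (X := ∀ i, LocalizedModule p.asIdeal.primeCompl (E i))
    (.pi fun i => LocalizedModule.mkLinearMap p.asIdeal.primeCompl (E i) ∘ₗ .proj i),
    Module.length_pi_of_fintype, finsum_eq_sum_of_fintype]
  rfl

theorem localLength_eq_zero {p : PrimeSpectrum A}
    (hM : ∀ x : M, ∃ s ∈ p.asIdeal.primeCompl, s • x = 0) : localLength M p = 0 := by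
  have := LocalizedModule.subsingleton_iff.2 hM
  exact Module.length_eq_zero

/-- The localisation map `A ⧸ I → A_p ⧸ I A_p`. -/
def quotientToLocalization (p : PrimeSpectrum A) (I : Ideal A) :
    A ⧸ I →ₗ[A] Localization p.asIdeal.primeCompl ⧸
      Submodule.localized' (Localization p.asIdeal.primeCompl) p.asIdeal.primeCompl
        (Algebra.linearMap A (Localization p.asIdeal.primeCompl)) I :=
  Submodule.toLocalizedQuotient' (Localization p.asIdeal.primeCompl) p.asIdeal.primeCompl
    (Algebra.linearMap A (Localization p.asIdeal.primeCompl)) I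

instance (p : PrimeSpectrum A) (I : Ideal A) :
    IsLocalizedModule p.asIdeal.primeCompl (quotientToLocalization p I) :=
  IsLocalizedModule.toLocalizedQuotient' _ _ _ _

theorem localLength_quotient (p : PrimeSpectrum A) (I : Ideal A) :
    localLength (A ⧸ I) p = Module.length (Localization p.asIdeal.primeCompl)
      (Localization p.asIdeal.primeCompl ⧸
        I.map (algebraMap A (Localization p.asIdeal.primeCompl))) := by
  rw [← Ideal.localized'_eq_map _ p.asIdeal.primeCompl]
  exact localLength_eq (quotientToLocalization p I)

theorem localLength_quotient_span (p : PrimeSpectrum A) (a : A) :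
    localLength (A ⧸ Ideal.span {a}) p =
      Ring.ord (Localization p.asIdeal.primeCompl) (algebraMap A _ a) := by
  rw [localLength_quotient, Ideal.map_span, Set.image_singleton]
  rfl

theorem exists_smul_quotient_eq_zero {p : PrimeSpectrum A} {I : Ideal A} (h : ¬ I ≤ p.asIdeal)
    (x : A ⧸ I) : ∃ s ∈ p.asIdeal.primeCompl, s • x = 0 := by
  obtain ⟨a, ha, hap⟩ := SetLike.not_le_iff_exists.1 h
  obtain ⟨y, rfl⟩ := Ideal.Quotient.mk_surjective x
  exact ⟨a, hap, Ideal.Quotient.eq_zero_iff_mem.2 (I.mul_mem_right y ha)⟩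

theorem exists_smul_pi_eq_zero {p : PrimeSpectrum A} {ι : Type*} [Finite ι] {E : ι → Type*}
    [∀ i, AddCommGroup (E i)] [∀ i, Module A (E i)]
    (h : ∀ i (x : E i), ∃ s ∈ p.asIdeal.primeCompl, s • x = 0) (x : ∀ i, E i) :
    ∃ s ∈ p.asIdeal.primeCompl, s • x = 0 := by
  cases nonempty_fintype ι
  choose s hs hsx using fun i => h i (x i)
  refine ⟨∏ i, s i, prod_mem fun i _ => hs i, funext fun i => ?_⟩
  obtain ⟨t, ht⟩ := Finset.dvd_prod_of_mem s (Finset.mem_univ i)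
  rw [Pi.smul_apply, ht, mul_comm, mul_smul, hsx, smul_zero, Pi.zero_apply]

end LocalEquiv

/-! ### Discrete valuation rings at the primes of an amenable module -/

section DiscreteValuation

variable {A : Type u} [CommRing A] {p : PrimeSpectrum A}

/-- If `xy = 0`, one factor divides the other, say `x = yc`; then `x² = c · xy = 0`, and reducedness
gives `x = 0`. -/
theorem isDomain_of_isReduced_of_total {R : Type*} [CommRing R] [Nontrivial R] [IsReduced R]
    (h : ∀ I J : Ideal R, I ≤ J ∨ J ≤ I) : IsDomain R := by
  have key : ∀ x y : R, x * y = 0 → Ideal.span {x} ≤ Ideal.span {y} → x = 0 := by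
    intro x y hxy hle
    obtain ⟨c, rfl⟩ := Ideal.mem_span_singleton.1 (Ideal.span_singleton_le_iff_mem _ |>.1 hle)
    refine pow_eq_zero_iff (n := 2) two_ne_zero |>.1 ?_
    linear_combination c * hxy
  have : NoZeroDivisors R := ⟨fun {x y} hxy => (h (Ideal.span {x}) (Ideal.span {y})).imp
    (key x y hxy) (key y x (by rw [mul_comm, hxy]))⟩
  exact NoZeroDivisors.to_isDomain R

variable (p) in
/-- The localisation at `p` is a discrete valuation ring. -/
def IsDiscreteValuationAt : Prop :=
  ∃ _ : IsDomain (Localization.AtPrime p.asIdeal),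
    IsDiscreteValuationRing (Localization.AtPrime p.asIdeal)

theorem isDiscreteValuationAt_of_isPrincipal (hp : p.asIdeal.height = 1)
    [IsDomain (Localization.AtPrime p.asIdeal)]
    (h : (IsLocalRing.maximalIdeal (Localization.AtPrime p.asIdeal)).IsPrincipal) :
    IsDiscreteValuationAt p := by
  have hm : (IsLocalRing.maximalIdeal (Localization.AtPrime p.asIdeal)).height = 1 := by
    -- Height one leaves the maximal ideal as the only nonzero prime, so its principality makes all
    -- primes, hence all ideals, principal.
    rw [← IsLocalization.height_under p.asIdeal.primeCompl,
      IsLocalization.AtPrime.under_maximalIdeal _ p.asIdeal, hp]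
  have := IsPrincipalIdealRing.of_prime_ne_bot (R := Localization.AtPrime p.asIdeal)
    fun P hP hP0 => by
      have hle := IsLocalRing.le_maximalIdeal hP.ne_top
      have hP1 : P.height ≤ 1 := hm ▸ Ideal.height_mono hle
      have : P.FiniteHeight := ⟨Or.inr (ne_top_of_le_ne_top (by simp) hP1)⟩
      have hPm : P = IsLocalRing.maximalIdeal _ := Ideal.eq_of_le_of_height_le _ hle (by
        rw [hm, Order.one_le_iff_ne_zero, Ne, Ideal.height_eq_zero_iff_eq_bot]
        exact hP0)
      exact hPm ▸ h
  exact ⟨inferInstance, { not_a_field' := fun h0 => by simp [h0] at hm }⟩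

/-- Valuation rings are Bézout, so finite generation of `p` makes the maximal ideal of `A_p`
principal. -/
theorem isDiscreteValuationAt_of_isValuationAt [IsReduced A] (hp : p.asIdeal.height = 1)
    (hfg : p.asIdeal.FG) (h : IsValuationAt A p) :
    IsDiscreteValuationAt p := by
  have : IsReduced (Localization.AtPrime p.asIdeal) :=
    inferInstance
  have := isDomain_of_isReduced_of_total h
  have : ValuationRing (Localization.AtPrime p.asIdeal) :=
    ValuationRing.iff_ideal_total.2 ⟨h⟩
  refine isDiscreteValuationAt_of_isPrincipal hp (IsBezout.isPrincipal_of_FG _ ?_)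
  rw [← Localization.AtPrime.map_eq_maximalIdeal]
  exact hfg.map _

theorem IsAmenableModule.isDiscreteValuationAt [IsReduced A] {M : Type v} [AddCommGroup M]
    [Module A M] (hM : IsAmenableModule A M) (hp : p ∈ torsionHeightOnePrimes A M) :
    IsDiscreteValuationAt p := by
  refine isDiscreteValuationAt_of_isValuationAt hp.1 (hM.fg_primes p hp) (hM.valuation p ?_)
  refine ⟨Set.subset_biUnion_of_mem (u := fun q : PrimeSpectrum A => (q.asIdeal : Set A)) hp,
    fun p' hp' hle => ?_⟩
  -- Prime avoidance puts a competing prime inside a single `q` of `𝒫_A(M)`; since `p` and `q` both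
  -- have height one, `p = q`. Hence `p` is maximal in the sense of (P₁).
  rw [← hM.finite_primes.coe_toFinset] at hp'
  obtain ⟨q, hq, hle'⟩ := (Ideal.subset_union_prime (f := PrimeSpectrum.asIdeal) p p
    fun q _ _ _ => q.2).1 hp'
  rw [Set.Finite.mem_toFinset] at hq
  have : p.asIdeal.FiniteHeight := ⟨Or.inr (by rw [hp.1]; simp)⟩
  have := Ideal.eq_of_le_of_height_le _ (le_trans (b := p'.asIdeal) hle hle')
    (by rw [hp.1, hq.1])
  exact hle'.trans this.ge

theorem isReduced_of_isSemisimpleRing_fractionRing (h : IsSemisimpleRing (FractionRing A)) :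
    IsReduced A := by
  have : IsReduced (FractionRing A) := inferInstance
  exact isReduced_of_injective (algebraMap A (FractionRing A)) (IsFractionRing.injective A _)

theorem Ring.ord_irreducible {R : Type*} [CommRing R] [IsDomain R] [IsDiscreteValuationRing R]
    {ϖ : R} (h : Irreducible ϖ) : Ring.ord R ϖ = 1 := by
  rw [Ring.ord, Module.length_eq_one_iff, isSimpleModule_iff_isCoatom, ← Ideal.isMaximal_def]
  exact PrincipalIdealRing.isMaximal_of_irreducible h

theorem Ring.ord_ne_top_of_ne_zero {R : Type*} [CommRing R] [IsDomain R]
    [IsDiscreteValuationRing R] {a : R} (ha : a ≠ 0) : Ring.ord R a ≠ ⊤ := by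
  obtain ⟨ϖ, hϖ⟩ := IsDiscreteValuationRing.exists_irreducible R
  obtain ⟨n, hn⟩ := IsDiscreteValuationRing.associated_pow_irreducible ha hϖ
  have : Ideal.span {a} = Ideal.span {ϖ ^ n} := Ideal.span_singleton_eq_span_singleton.2 hn
  rw [Ring.ord, this]
  change Ring.ord R (ϖ ^ n) ≠ ⊤
  rw [Ring.ord_pow (mem_nonZeroDivisors_of_ne_zero hϖ.ne_zero), Ring.ord_irreducible hϖ]
  simp

theorem localLength_quotient_pow (hp : IsDiscreteValuationAt p) (n : ℕ) :
    localLength (A ⧸ p.asIdeal ^ n) p = n := by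
  obtain ⟨_, _⟩ := hp
  obtain ⟨ϖ, hϖ⟩ := IsDiscreteValuationRing.exists_irreducible (Localization.AtPrime p.asIdeal)
  rw [localLength_quotient, Ideal.map_pow, Localization.AtPrime.map_eq_maximalIdeal,
    hϖ.maximalIdeal_eq, Ideal.span_singleton_pow]
  change Ring.ord _ (ϖ ^ n) = n
  rw [Ring.ord_pow (mem_nonZeroDivisors_of_ne_zero hϖ.ne_zero), Ring.ord_irreducible hϖ]
  simp

end DiscreteValuation

/-! ### Existence and uniqueness of the characteristic ideal -/

section Structure

variable {A : Type u} [CommRing A] {M : Type v} [AddCommGroup M] [Module A M]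

theorem isTorsion_localizedModule (hM : Module.IsTorsion A M) (p : PrimeSpectrum A) :
    Module.IsTorsion (Localization.AtPrime p.asIdeal)
      (LocalizedModule p.asIdeal.primeCompl M) := by
  intro x
  induction x using LocalizedModule.induction_on with
  | h m s =>
    obtain ⟨a, ha⟩ := @hM m
    refine ⟨⟨algebraMap A _ (a : A), IsLocalization.map_nonZeroDivisors_le p.asIdeal.primeCompl _
      (Submonoid.mem_map_of_mem _ a.2)⟩, ?_⟩
    change algebraMap A (Localization p.asIdeal.primeCompl) (a : A) • LocalizedModule.mk m s = 0
    rw [algebraMap_smul, LocalizedModule.smul'_mk]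
    have ha' : (a : A) • m = 0 := ha
    rw [ha', LocalizedModule.zero_mk]

/-- The structure theorem over the principal ideal domain `A_p` decomposes `M_p`, and finite
presentation of `M` lifts the decomposition to a map over `A`, up to a factor outside `p`. -/
theorem exists_isLocalEquiv_pi [Module.FinitePresentation A M] (hM : Module.IsTorsion A M)
    {p : PrimeSpectrum A} (hp : IsDiscreteValuationAt p) :
    ∃ (k : ℕ) (e : Fin k → ℕ) (f : M →ₗ[A] ∀ i, A ⧸ p.asIdeal ^ e i), IsLocalEquiv p f := by
  obtain ⟨_, _⟩ := hp
  obtain ⟨ι, _, ϖ, hϖ, e, ⟨φ⟩⟩ :=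
    Module.equiv_directSum_of_isTorsion (isTorsion_localizedModule hM p)
  have hI : ∀ i, Submodule.span _ {ϖ i ^ e i} =
      Submodule.localized' (Localization.AtPrime p.asIdeal) p.asIdeal.primeCompl
        (Algebra.linearMap A (Localization.AtPrime p.asIdeal)) (p.asIdeal ^ e i) := by
    intro i
    rw [Ideal.localized'_eq_map, Ideal.map_pow, Localization.AtPrime.map_eq_maximalIdeal,
      (hϖ i).maximalIdeal_eq, Ideal.span_singleton_pow]
  let ψ := (φ.trans (DirectSum.linearEquivFunOnFintype _ _ _)).trans
    (LinearEquiv.piCongrRight fun i => Submodule.quotEquivOfEq _ _ (hI i))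
  let g : (∀ i, A ⧸ p.asIdeal ^ e i) →ₗ[A] _ :=
    .pi fun i => quotientToLocalization p (p.asIdeal ^ e i) ∘ₗ .proj i
  have : IsLocalizedModule p.asIdeal.primeCompl g := inferInstance
  let h := (ψ.restrictScalars A).toLinearMap ∘ₗ
    LocalizedModule.mkLinearMap p.asIdeal.primeCompl M
  have : IsLocalizedModule p.asIdeal.primeCompl h := inferInstance
  obtain ⟨f, s, hf⟩ := Module.FinitePresentation.exists_lift_of_isLocalizedModule
    p.asIdeal.primeCompl g h
  exact ⟨Fintype.card ι, fun j => e ((Fintype.equivFin ι).symm j), _,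
    (IsLocalEquiv.of_comp_eq_smul g h s hf).linearEquiv_comp
      (LinearEquiv.piCongrLeft' A (fun i => A ⧸ p.asIdeal ^ e i) (Fintype.equivFin ι))⟩

variable (A M) in
/-- For finite `𝒫_A(M)` the direct sum `⨁_𝔭 ⨁ᵢ A / 𝔭 ^ e_{𝔭,i}` is a product. -/
def primePowerSumEquiv [Finite (torsionHeightOnePrimes A M)] (k : torsionHeightOnePrimes A M → ℕ)
    (e : ∀ p : torsionHeightOnePrimes A M, Fin (k p) → ℕ) :
    PrimePowerSum A M k e ≃ₗ[A] ∀ (p : torsionHeightOnePrimes A M) (i : Fin (k p)),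
      A ⧸ p.1.asIdeal ^ e p i :=
  have := Fintype.ofFinite (torsionHeightOnePrimes A M)
  (DirectSum.linearEquivFunOnFintype A (torsionHeightOnePrimes A M)
    (fun p => ⨁ i : Fin (k p), A ⧸ (p.1.asIdeal ^ e p i))).trans
  (LinearEquiv.piCongrRight fun p => DirectSum.linearEquivFunOnFintype A (Fin (k p))
    (fun i => A ⧸ (p.1.asIdeal ^ e p i)))

theorem exists_smul_eq_zero_of_notMem (hM : Module.IsTorsion A M) {p : PrimeSpectrum A}
    (hp : p.asIdeal.height ≤ 1) (hpM : p ∉ torsionHeightOnePrimes A M) (x : M) :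
    ∃ s ∈ p.asIdeal.primeCompl, s • x = 0 := by
  obtain hp | hp := hp.lt_or_eq
  -- At a minimal prime torsion dies because non-zero-divisors avoid all minimal primes.
  · rw [Order.lt_one_iff, Ideal.height_eq_zero_iff] at hp
    obtain ⟨a, ha⟩ := @hM x
    exact ⟨a, fun h => notMem_nonZeroDivisors_of_mem_mem_minimalPrimes h hp a.2, ha⟩
  · have h : p ∉ Module.support A (Submodule.torsion A M) := fun h => hpM ⟨hp, h⟩
    rw [Module.notMem_support_iff, LocalizedModule.subsingleton_iff] at h
    obtain ⟨s, hs, h'⟩ := h ⟨x, @hM x⟩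
    exact ⟨s, hs, congrArg Subtype.val h'⟩

/-- Were `q ^ e ≤ p`, then `q ≤ p`, and the heights would force equality. So in the direct sum only
the block of `p` itself survives localisation at `p`. -/
theorem exists_smul_primePower_eq_zero {p q : PrimeSpectrum A} (hq : q.asIdeal.height = 1)
    (hp : p.asIdeal.height ≤ 1) (hpq : p ≠ q) {k : ℕ} (e : Fin k → ℕ)
    (x : ∀ i, A ⧸ q.asIdeal ^ e i) : ∃ s ∈ p.asIdeal.primeCompl, s • x = 0 := by
  refine exists_smul_pi_eq_zero (fun i => exists_smul_quotient_eq_zero fun h => hpq ?_) x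
  have hle : q.asIdeal ≤ p.asIdeal := Ideal.IsPrime.le_of_pow_le h
  have : q.asIdeal.FiniteHeight := ⟨Or.inr (by rw [hq]; simp)⟩
  exact PrimeSpectrum.ext (Ideal.eq_of_le_of_height_le _ hle (by rw [hq]; exact hp)).symm

theorem exists_isCharIdeal [Module.FinitePresentation A M] (hM : Module.IsTorsion A M)
    (hfin : (torsionHeightOnePrimes A M).Finite)
    (hdv : ∀ p ∈ torsionHeightOnePrimes A M, IsDiscreteValuationAt p) :
    ∃ J, IsCharIdeal A M J := by
  have := hfin.to_subtype
  choose k e f hf using fun p : torsionHeightOnePrimes A M =>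
    exists_isLocalEquiv_pi hM (hdv p p.2)
  refine ⟨_, k, e, (primePowerSumEquiv A M k e).symm.toLinearMap ∘ₗ LinearMap.pi f, ?_, rfl⟩
  rw [isPseudoIso_iff]
  intro p hp
  apply IsLocalEquiv.linearEquiv_comp
  by_cases hpM : p ∈ torsionHeightOnePrimes A M
  · refine ⟨fun x hx => (hf ⟨p, hpM⟩).1 x (congrFun hx ⟨p, hpM⟩), fun y => ?_⟩
    obtain ⟨s, hs, x, hx⟩ := (hf ⟨p, hpM⟩).2 (y ⟨p, hpM⟩)
    -- The preimage `x` is right only in the `p`-block; the error in each other block is killed by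
    -- some `t q` outside `p`, and the product of these corrects all blocks at once.
    have key : ∀ q : torsionHeightOnePrimes A M, ∃ t ∈ p.asIdeal.primeCompl,
        t • (LinearMap.pi f x - s • y) q = 0 := by
      intro q
      by_cases hq : p = q
      · obtain rfl : ⟨p, hpM⟩ = q := Subtype.ext hq
        exact ⟨1, one_mem _, by simp [hx]⟩
      · exact exists_smul_primePower_eq_zero q.2.1 hp hq _ _
    choose t ht htx using key
    cases nonempty_fintype (torsionHeightOnePrimes A M)
    refine ⟨(∏ q, t q) * s, mul_mem (prod_mem fun q _ => ht q) hs, (∏ q, t q) • x, ?_⟩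
    rw [map_smul, mul_smul, ← sub_eq_zero, ← smul_sub]
    funext q
    obtain ⟨c, hc⟩ := Finset.dvd_prod_of_mem t (Finset.mem_univ q)
    rw [Pi.smul_apply, hc, mul_comm, mul_smul, htx, smul_zero, Pi.zero_apply]
  · exact .of_forall_exists_smul_eq_zero _ (exists_smul_eq_zero_of_notMem hM hp hpM)
      (exists_smul_pi_eq_zero fun q => exists_smul_primePower_eq_zero q.2.1 hp
        (fun h => hpM (h ▸ q.2)) _)

/-- The right-hand side mentions no pseudo-isomorphism, which gives uniqueness. Its index set does
not depend on `M`, so characteristic ideals of different modules can be compared factor by factor.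
-/
theorem IsCharIdeal.eq_finprod {J : Ideal A} (hJ : IsCharIdeal A M J)
    (hM : Module.IsTorsion A M) (hfin : (torsionHeightOnePrimes A M).Finite)
    (hdv : ∀ p ∈ torsionHeightOnePrimes A M, IsDiscreteValuationAt p) :
    J = ∏ᶠ p ∈ {p : PrimeSpectrum A | p.asIdeal.height = 1},
      p.asIdeal ^ (localLength M p).toNat := by
  have := hfin.to_subtype
  obtain ⟨k, e, f, hf, rfl⟩ := hJ
  rw [isPseudoIso_iff] at hf
  have hlen : ∀ p : torsionHeightOnePrimes A M, localLength M p.1 = ∑ i, e p i := by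
    intro p
    have hp := p.2.1.le
    rw [((hf p hp).linearEquiv_comp (primePowerSumEquiv A M k e)).localLength_eq,
      localLength_pi, finsum_eq_single _ p]
    · rw [localLength_pi, finsum_eq_sum_of_fintype, Nat.cast_sum]
      exact Finset.sum_congr rfl fun i _ => localLength_quotient_pow (hdv p p.2) _
    · exact fun q hq => localLength_eq_zero <|
        exists_smul_primePower_eq_zero q.2.1 hp (fun h => hq (Subtype.ext h.symm)) _
  have h1 : ∀ p : torsionHeightOnePrimes A M,
      p.1.asIdeal ^ (∑ i, e p i) = p.1.asIdeal ^ (localLength M p.1).toNat := by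
    intro p
    rw [hlen, ENat.toNat_natCast]
  rw [finprod_congr h1, finprod_set_coe_eq_finprod_mem (torsionHeightOnePrimes A M)
    (f := fun p => p.asIdeal ^ (localLength M p).toNat)]
  -- Height-one primes outside `𝒫_A(M)` have local length zero and contribute trivial factors.
  refine finprod_mem_inter_mulSupport_eq' _ _ _ fun p hp => ⟨fun h => h.1, fun h => ?_⟩
  by_contra hpM
  refine hp ?_
  have h' : p.asIdeal.height = 1 := h
  simp only [localLength_eq_zero (exists_smul_eq_zero_of_notMem hM h'.le hpM)]
  simp

theorem existsUnique_isCharIdeal [Module.FinitePresentation A M] (hM : Module.IsTorsion A M)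
    (hfin : (torsionHeightOnePrimes A M).Finite)
    (hdv : ∀ p ∈ torsionHeightOnePrimes A M, IsDiscreteValuationAt p) :
    ∃! J, IsCharIdeal A M J := by
  obtain ⟨J, hJ⟩ := exists_isCharIdeal hM hfin hdv
  exact ⟨J, hJ, fun J' hJ' => (hJ'.eq_finprod hM hfin hdv).trans (hJ.eq_finprod hM hfin hdv).symm⟩

theorem IsAmenableModule.existsUnique_isCharIdeal [Module.FinitePresentation A M]
    (h : IsAmenableModule A M) (hA : IsSemisimpleRing (FractionRing A))
    (hM : Module.IsTorsion A M) : ∃! J, IsCharIdeal A M J := by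
  have := isReduced_of_isSemisimpleRing_fractionRing hA
  exact _root_.existsUnique_isCharIdeal hM h.finite_primes fun p => h.isDiscreteValuationAt

theorem isCharIdeal_charIdeal (h : ∃ J, IsCharIdeal A M J) :
    IsCharIdeal A M (charIdeal A M) := by
  rw [charIdeal, dif_pos h]
  exact h.choose_spec

theorem IsAmenableModule.fg_of_isCharIdeal (h : IsAmenableModule A M) {J : Ideal A}
    (hJ : IsCharIdeal A M J) : J.FG := by
  obtain ⟨k, e, f, -, rfl⟩ := hJ
  exact finprod_induction (p := Submodule.FG)
    (by rw [Ideal.one_eq_top]; exact ⟨{1}, by simp⟩) (fun _ _ => Ideal.FG.mul)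
    fun p => Ideal.FG.pow (h.fg_primes p p.2)

end Structure

/-! ### Factorial domains: principal characteristic ideals -/

section UniqueFactorization

variable {A : Type u} [CommRing A]

theorem finitePresentation_pi_quotient_span {ι : Type*} [Finite ι] (a : ι → A) :
    Module.FinitePresentation A (∀ i, A ⧸ Ideal.span {a i}) := by
  refine Module.finitePresentation_of_surjective (M := ι → A)
    (.pi fun i => (Ideal.span {a i}).mkQ ∘ₗ .proj i) ?_ ?_
  · intro y
    choose x hx using fun i => Submodule.mkQ_surjective (Ideal.span {a i}) (y i)
    exact ⟨x, funext hx⟩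
  -- The relation module is the image of the diagonal matrix with entries `a i`, hence finitely
  -- generated.
  · let D : (ι → A) →ₗ[A] ι → A := .pi fun i => a i • .proj i
    have : LinearMap.ker (.pi fun i => (Ideal.span {a i}).mkQ ∘ₗ .proj i :
        (ι → A) →ₗ[A] ∀ i, A ⧸ Ideal.span {a i}) = LinearMap.range D := by
      ext x
      simp only [LinearMap.mem_ker, LinearMap.mem_range, funext_iff]
      have h : ∀ i, (Ideal.span {a i}).mkQ (x i) = 0 ↔ ∃ c, a i * c = x i := fun i => by
        rw [Submodule.mkQ_apply, Submodule.Quotient.mk_eq_zero, Ideal.mem_span_singleton']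
        simp only [mul_comm]
      constructor
      · intro hx
        choose c hc using fun i => (h i).1 (hx i)
        exact ⟨c, hc⟩
      · rintro ⟨c, hc⟩ i
        exact (h i).2 ⟨c i, hc i⟩
    rw [this]
    exact LinearMap.range_eq_map D ▸ Module.Finite.fg_top.map D

theorem isTorsion_pi_quotient_span [IsDomain A] {ι : Type*} [Fintype ι] {a : ι → A}
    (ha : ∏ i, a i ≠ 0) : Module.IsTorsion A (∀ i, A ⧸ Ideal.span {a i}) := by
  refine fun x => ⟨⟨_, mem_nonZeroDivisors_of_ne_zero ha⟩, funext fun i => ?_⟩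
  obtain ⟨y, hy⟩ := Submodule.mkQ_surjective _ (x i)
  obtain ⟨c, hc⟩ := Finset.dvd_prod_of_mem a (Finset.mem_univ i)
  change (∏ i, a i) • x i = 0
  rw [← hy, ← map_smul, Submodule.mkQ_apply, Submodule.Quotient.mk_eq_zero, hc, smul_eq_mul,
    mul_assoc]
  exact Ideal.mul_mem_right _ _ (Ideal.mem_span_singleton_self _)

theorem Module.IsTorsion.of_linearEquiv {M N : Type*} [AddCommGroup M] [Module A M]
    [AddCommGroup N] [Module A N] (e : M ≃ₗ[A] N) (h : Module.IsTorsion A N) :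
    Module.IsTorsion A M := by
  intro x
  obtain ⟨a, ha⟩ := @h (e x)
  refine ⟨a, e.injective ?_⟩
  rw [map_zero, ← ha]
  exact map_smul e (a : A) x

theorem localLength_quotient_span_eq_zero {p : PrimeSpectrum A} {a : A} (h : a ∉ p.asIdeal) :
    localLength (A ⧸ Ideal.span {a}) p = 0 :=
  localLength_eq_zero (exists_smul_quotient_eq_zero fun hle =>
    h (hle (Ideal.mem_span_singleton_self a)))

theorem localLength_quotient_span_mul [IsDomain A] {p : PrimeSpectrum A} {a b : A} (hb : b ≠ 0) :
    localLength (A ⧸ Ideal.span {a * b}) p =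
      localLength (A ⧸ Ideal.span {a}) p + localLength (A ⧸ Ideal.span {b}) p := by
  simp only [localLength_quotient_span, map_mul]
  exact Ring.ord_mul _ (IsLocalization.map_nonZeroDivisors_le p.asIdeal.primeCompl _
    (Submonoid.mem_map_of_mem _ (mem_nonZeroDivisors_of_ne_zero hb)))

theorem localLength_quotient_span_prod [IsDomain A] {p : PrimeSpectrum A} {ι : Type*} [Fintype ι] {a : ι → A}
    (ha : ∀ i, a i ≠ 0) :
    localLength (∀ i, A ⧸ Ideal.span {a i}) p = localLength (A ⧸ Ideal.span {∏ i, a i}) p := by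
  rw [localLength_pi, finsum_eq_sum_of_fintype]
  classical
  induction (Finset.univ : Finset ι) using Finset.induction_on with
  | empty =>
    rw [Finset.sum_empty, Finset.prod_empty, localLength_quotient_span_eq_zero]
    exact (Ideal.ne_top_iff_one _).1 p.2.ne_top
  | insert i s hi ih =>
    rw [Finset.sum_insert hi, Finset.prod_insert hi, ih,
      localLength_quotient_span_mul (Finset.prod_ne_zero_iff.2 fun j _ => ha j)]

theorem IsPseudoIso.linearEquiv_comp {M N N' : Type*} [AddCommGroup M]
    [Module A M] [AddCommGroup N] [Module A N] [AddCommGroup N'] [Module A N']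
    {f : M →ₗ[A] N} (hf : IsPseudoIso f) (e : N ≃ₗ[A] N') :
    IsPseudoIso (e.toLinearMap ∘ₗ f) := by
  rw [isPseudoIso_iff] at hf ⊢
  exact fun p hp => (hf p hp).linearEquiv_comp e

theorem isPseudoIso_id {M : Type*} [AddCommGroup M] [Module A M] :
    IsPseudoIso (LinearMap.id : M →ₗ[A] M) := by
  rw [isPseudoIso_iff]
  exact fun p _ => ⟨fun x hx => ⟨1, one_mem _, by rw [one_smul]; exact hx⟩,
    fun y => ⟨1, one_mem _, y, (one_smul _ _).symm⟩⟩

variable [IsDomain A] [UniqueFactorizationMonoid A]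

theorem exists_prime_eq_span {p : PrimeSpectrum A} (hp : p.asIdeal.height = 1) :
    ∃ π, Prime π ∧ p.asIdeal = Ideal.span {π} := by
  obtain ⟨π, hπ, h⟩ := p.2.exists_mem_prime_of_ne_bot (Ideal.ne_bot_of_height_eq_one hp)
  exact ⟨π, h, Ideal.eq_span_singleton_of_height_eq_one hp hπ h⟩

theorem isDiscreteValuationAt_of_height_eq_one {p : PrimeSpectrum A}
    (hp : p.asIdeal.height = 1) : IsDiscreteValuationAt p := by
  obtain ⟨π, -, h⟩ := exists_prime_eq_span hp
  have : IsDomain (Localization.AtPrime p.asIdeal) :=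
    IsLocalization.isDomain_localization p.asIdeal.primeCompl_le_nonZeroDivisors
  refine isDiscreteValuationAt_of_isPrincipal hp ⟨⟨algebraMap A _ π, ?_⟩⟩
  rw [← Localization.AtPrime.map_eq_maximalIdeal]
  refine (congrArg (Ideal.map (algebraMap A (Localization.AtPrime p.asIdeal))) h).trans ?_
  rw [Ideal.map_span, Set.image_singleton]

theorem height_span_prime {π : A} (hπ : Prime π) : (Ideal.span {π}).height = 1 := by
  have : (Ideal.span {π}).IsPrime := (Ideal.span_singleton_prime hπ.ne_zero).2 hπ
  apply le_antisymm
  · refine (Ideal.height_le_iff (n := 1)).2 fun q hq hlt => ?_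
    rw [Nat.cast_one, Order.lt_one_iff, Ideal.height_eq_zero_iff_eq_bot]
    by_contra h0
    -- A nonzero prime strictly inside `(π)` would contain a prime element divisible by `π`, hence
    -- associated to it, and so would contain `π`.
    obtain ⟨ρ, hρ, h⟩ := hq.exists_mem_prime_of_ne_bot h0
    have := hπ.irreducible.dvd_symm h.irreducible (Ideal.mem_span_singleton.1 (hlt.le hρ))
    exact hlt.not_ge ((Ideal.span_singleton_le_iff_mem _).2 (q.mem_of_dvd this hρ))
  · rw [Order.one_le_iff_ne_zero, Ne, Ideal.height_eq_zero_iff_eq_bot]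
    simpa using hπ.ne_zero

/-- Such primes are generated by prime factors of `a`, of which there are finitely many up to units.
-/
theorem finite_setOf_height_eq_one_mem {a : A} (ha : a ≠ 0) :
    {p : PrimeSpectrum A | p.asIdeal.height = 1 ∧ a ∈ p.asIdeal}.Finite := by
  classical
  refine Set.Finite.of_finite_image (f := PrimeSpectrum.asIdeal) ?_
    (fun p _ q _ h => PrimeSpectrum.ext h)
  refine ((UniqueFactorizationMonoid.factors a).toFinset.finite_toSet.image
    fun π => Ideal.span {π}).subset ?_
  rintro _ ⟨p, ⟨hp, hap⟩, rfl⟩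
  obtain ⟨π, hπ, h⟩ := exists_prime_eq_span hp
  rw [h, Ideal.mem_span_singleton] at hap
  obtain ⟨ρ, hρ, hass⟩ := UniqueFactorizationMonoid.exists_mem_factors_of_dvd ha hπ.irreducible hap
  exact ⟨ρ, by simpa using hρ, by rw [h, Ideal.span_singleton_eq_span_singleton.2 hass]⟩

theorem finite_torsionHeightOnePrimes (M : Type v) [AddCommGroup M] [Module A M]
    [Module.Finite A M] (hM : Module.IsTorsion A M) : (torsionHeightOnePrimes A M).Finite := by
  obtain ⟨a, ha, ha0⟩ := Submodule.annihilator_top_inter_nonZeroDivisors hM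
  refine (finite_setOf_height_eq_one_mem (nonZeroDivisors.ne_zero ha0)).subset ?_
  rintro p ⟨hp, hpM⟩
  refine ⟨hp, ?_⟩
  by_contra hap
  refine Module.notMem_support_iff.2 (LocalizedModule.subsingleton_iff.2 fun x => ?_) hpM
  exact ⟨a, hap, Subtype.ext (Submodule.mem_annihilator.1 ha x trivial)⟩

theorem isAmenableModule_of_isTorsion (M : Type v) [AddCommGroup M] [Module A M]
    [Module.Finite A M] (hM : Module.IsTorsion A M) : IsAmenableModule A M where
  finite := inferInstance
  finite_primes := finite_torsionHeightOnePrimes M hM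
  fg_primes q hq := by
    obtain ⟨π, -, h⟩ := exists_prime_eq_span hq.1
    rw [h]
    exact Submodule.fg_span_singleton π
  valuation p hp := by
    have hsub := hp.1
    rw [← (finite_torsionHeightOnePrimes M hM).coe_toFinset] at hsub
    obtain ⟨q, hq, hle⟩ := (Ideal.subset_union_prime (f := PrimeSpectrum.asIdeal) p p
      fun q _ _ _ => q.2).1 hsub
    rw [Set.Finite.mem_toFinset] at hq
    obtain rfl : p = q := le_antisymm hle (hp.2
      (Set.subset_biUnion_of_mem (u := fun q : PrimeSpectrum A => (q.asIdeal : Set A)) hq) hle)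
    obtain ⟨_, _⟩ := isDiscreteValuationAt_of_height_eq_one hq.1
    exact (ValuationRing.iff_ideal_total (R := Localization.AtPrime p.asIdeal)).1
      inferInstance |>.total

/-- The product of `p ^ ord_p(a)` over the primes `p` of height one. -/
def ordProd (a : A) : Ideal A :=
  ∏ᶠ p ∈ {p : PrimeSpectrum A | p.asIdeal.height = 1},
    p.asIdeal ^ (localLength (A ⧸ Ideal.span {a}) p).toNat

theorem localLength_quotient_span_ne_top {p : PrimeSpectrum A} (hp : p.asIdeal.height = 1) {a : A}
    (ha : a ≠ 0) : localLength (A ⧸ Ideal.span {a}) p ≠ ⊤ := by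
  obtain ⟨_, _⟩ := isDiscreteValuationAt_of_height_eq_one hp
  rw [localLength_quotient_span]
  refine Ring.ord_ne_top_of_ne_zero (R := Localization.AtPrime p.asIdeal) ?_
  exact nonZeroDivisors.ne_zero (IsLocalization.map_nonZeroDivisors_le p.asIdeal.primeCompl _
    (Submonoid.mem_map_of_mem _ (mem_nonZeroDivisors_of_ne_zero ha)))

theorem ordProd_mul {a b : A} (ha : a ≠ 0) (hb : b ≠ 0) :
    ordProd (a * b) = ordProd a * ordProd b := by
  -- Splitting the product needs finite supports, since `finprod` takes the default value `1`
  -- otherwise; likewise `toNat` is additive only on finite lengths.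
  have hfin : ∀ {c : A}, c ≠ 0 → ({p : PrimeSpectrum A | p.asIdeal.height = 1} ∩
      Function.mulSupport fun p : PrimeSpectrum A =>
        p.asIdeal ^ (localLength (A ⧸ Ideal.span {c}) p).toNat).Finite := by
    refine fun hc => (finite_setOf_height_eq_one_mem hc).subset fun p hp => ⟨hp.1, ?_⟩
    by_contra h
    refine hp.2 ?_
    simp only [localLength_quotient_span_eq_zero h]
    simp
  rw [ordProd, ordProd, ordProd, ← finprod_mem_mul_distrib' (hfin ha) (hfin hb)]
  refine finprod_mem_congr rfl fun p hp => ?_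
  rw [localLength_quotient_span_mul hb, ENat.toNat_add (localLength_quotient_span_ne_top hp ha)
    (localLength_quotient_span_ne_top hp hb), pow_add]

theorem ordProd_prime {π : A} (hπ : Prime π) : ordProd π = Ideal.span {π} := by
  let P : PrimeSpectrum A :=
    ⟨Ideal.span {π}, (Ideal.span_singleton_prime hπ.ne_zero).2 hπ⟩
  have hP : P.asIdeal.height = 1 := height_span_prime hπ
  have hlen : localLength (A ⧸ Ideal.span {π}) P = 1 := by
    have := localLength_quotient_pow (isDiscreteValuationAt_of_height_eq_one hP) 1
    rwa [pow_one, Nat.cast_one] at this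
  have : ordProd π = ∏ᶠ p ∈ ({P} : Set (PrimeSpectrum A)),
      p.asIdeal ^ (localLength (A ⧸ Ideal.span {π}) p).toNat := by
    refine finprod_mem_inter_mulSupport_eq' _ _ _ fun p hp => ⟨fun h => ?_, fun h => ?_⟩
    · have hmem : π ∈ p.asIdeal := by
        by_contra hmem
        refine hp ?_
        simp only [localLength_quotient_span_eq_zero hmem]
        simp
      exact PrimeSpectrum.ext (Ideal.eq_span_singleton_of_height_eq_one h hmem hπ)
    · rw [Set.mem_singleton_iff.1 h]
      exact hP
  rw [this, finprod_mem_singleton, hlen]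
  simp [P]

theorem ordProd_eq_span {a : A} (ha : a ≠ 0) : ordProd a = Ideal.span {a} := by
  induction a using UniqueFactorizationMonoid.induction_on_prime with
  | h₁ => exact absurd rfl ha
  | h₂ x hx =>
    rw [Ideal.span_singleton_eq_top.2 hx, ← Ideal.one_eq_top, ordProd]
    refine finprod_mem_of_eqOn_one fun p _ => ?_
    simp only [localLength_quotient_span_eq_zero fun h =>
      p.2.ne_top (Ideal.eq_top_of_isUnit_mem _ h hx)]
    simp
  | h₃ a p ha' hp ih =>
    rw [ordProd_mul hp.ne_zero ha', ih ha', ordProd_prime hp,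
      Ideal.span_singleton_mul_span_singleton]

/-- Both sides are the product of `p ^ length` over all height-one primes. The `a i` need not be
prime powers; this matters at finite level, where a prime of `A` may become reducible in `A_n`. -/
theorem IsCharIdeal.eq_span {M : Type v} [AddCommGroup M] [Module A M] [Module.Finite A M]
    {J : Ideal A} (hJ : IsCharIdeal A M J) (hM : Module.IsTorsion A M) {ι : Type*} [Fintype ι]
    {a : ι → A} (ha : ∏ i, a i ≠ 0) (f : M →ₗ[A] ∀ i, A ⧸ Ideal.span {a i})
    (hf : IsPseudoIso f) : J = Ideal.span {∏ i, a i} := by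
  rw [hJ.eq_finprod hM (finite_torsionHeightOnePrimes M hM)
    fun p hp => isDiscreteValuationAt_of_height_eq_one hp.1, ← ordProd_eq_span ha, ordProd]
  refine finprod_mem_congr rfl fun p hp => ?_
  have hp' : p.asIdeal.height = 1 := hp
  rw [((isPseudoIso_iff f).1 hf p hp'.le).localLength_eq, localLength_quotient_span_prod]
  exact fun i => Finset.prod_ne_zero_iff.1 ha i (Finset.mem_univ i)

/-- Over a unique factorisation domain the elementary modules are products of cyclic modules
with a principal annihilator. -/
theorem exists_primePowerSum_equiv (M : Type v) [AddCommGroup M] [Module A M]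
    [Finite (torsionHeightOnePrimes A M)] (k : torsionHeightOnePrimes A M → ℕ)
    (e : ∀ p : torsionHeightOnePrimes A M, Fin (k p) → ℕ) :
    ∃ (a : (Σ p : torsionHeightOnePrimes A M, Fin (k p)) → A),
      (∀ x, a x ≠ 0) ∧ Nonempty (PrimePowerSum A M k e ≃ₗ[A] ∀ x, A ⧸ Ideal.span {a x}) := by
  choose π hπ h using fun p : torsionHeightOnePrimes A M => exists_prime_eq_span p.2.1
  refine ⟨fun x => π x.1 ^ e x.1 x.2, fun x => pow_ne_zero _ (hπ x.1).ne_zero, ⟨?_⟩⟩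
  have h' : ∀ p (i : Fin (k p)), p.1.asIdeal ^ e p i = Ideal.span {π p ^ e p i} := fun p i => by
    rw [h, Ideal.span_singleton_pow]
  let g : (∀ p (i : Fin (k p)), A ⧸ p.1.asIdeal ^ e p i) ≃ₗ[A]
      ∀ p (i : Fin (k p)), A ⧸ Ideal.span {π p ^ e p i} :=
    LinearEquiv.piCongrRight fun p => LinearEquiv.piCongrRight fun i =>
      Submodule.quotEquivOfEq _ _ (h' p i)
  exact ((primePowerSumEquiv A M k e).trans g).trans
    (LinearEquiv.piCurry A fun p i => A ⧸ Ideal.span {π p ^ e p i}).symm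

end UniqueFactorization

/-! ### Reduction of products of cyclic modules modulo `I_n` -/

namespace RingTower

variable (S : RingTower.{u})

theorem exists_level_linearEquiv {M : Type v} [AddCommGroup M] [Module S.Lim M] {ι : Type*}
    [Finite ι] {a : ι → S.Lim} (e : M ≃ₗ[S.Lim] ∀ i, S.Lim ⧸ Ideal.span {a i}) (n : ℕ) :
    Nonempty (S.Level M n ≃ₗ[S.obj n] ∀ i, S.obj n ⧸ Ideal.span {S.proj n (a i)}) := by
  classical
  cases nonempty_fintype ι
  let : Algebra S.Lim (S.obj n) := (S.proj n).toAlgebra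
  have hle : ∀ i, Ideal.span {a i} ≤
      (Ideal.span {S.proj n (a i)}).comap (Algebra.ofId S.Lim (S.obj n)) := fun i =>
    (Ideal.span_singleton_le_iff_mem _).2 (Ideal.mem_span_singleton_self _)
  let q : ∀ i, (S.Lim ⧸ Ideal.span {a i}) →ₗ[S.Lim] S.obj n ⧸ Ideal.span {S.proj n (a i)} :=
    fun i => (Ideal.quotientMapₐ _ (Algebra.ofId S.Lim (S.obj n)) (hle i)).toLinearMap
  have hq : ∀ i c, q i (Ideal.Quotient.mk _ c) = Ideal.Quotient.mk _ (S.proj n c) :=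
    fun i c => rfl
  let T : M →ₗ[S.Lim] ∀ i, S.obj n ⧸ Ideal.span {S.proj n (a i)} :=
    (LinearMap.pi fun i => q i ∘ₗ LinearMap.proj i) ∘ₗ e.toLinearMap
  have hT : Function.Surjective T := by
    intro y
    have : ∀ i, ∃ x, q i x = y i := fun i => by
      obtain ⟨b, hb⟩ := Ideal.Quotient.mk_surjective (y i)
      obtain ⟨c, rfl⟩ := S.proj_surjective n b
      exact ⟨Ideal.Quotient.mk _ c, (hq i c).trans hb⟩
    choose x hx using this
    exact ⟨e.symm x, funext fun i => by simp [T, hx]⟩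
  have hker : S.kerIdeal n • (⊤ : Submodule S.Lim M) = LinearMap.ker T := by
    apply le_antisymm
    · refine Submodule.smul_le.2 fun r hr x _ => ?_
      rw [LinearMap.mem_ker, map_smul, ← algebraMap_smul (S.obj n)]
      have : algebraMap S.Lim (S.obj n) r = 0 := hr
      rw [this, zero_smul]
    · intro x hx
      have hmem : e x ∈ S.kerIdeal n • (⊤ : Submodule S.Lim (∀ i, S.Lim ⧸ Ideal.span {a i})) := by
        rw [← Finset.univ_sum_single (e x)]
        refine Submodule.sum_mem _ fun i _ => ?_
        obtain ⟨c, hc⟩ := Ideal.Quotient.mk_surjective (e x i)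
        have hc0 : S.proj n c ∈ Ideal.span {S.proj n (a i)} := by
          rw [← Ideal.Quotient.eq_zero_iff_mem, ← hq, hc]
          exact congrFun hx i
        obtain ⟨b, hb⟩ := Ideal.mem_span_singleton'.1 hc0
        obtain ⟨d, rfl⟩ := S.proj_surjective n b
        -- If `c` maps into the ideal generated by the image of `a i`, subtracting a lifted multiple
        -- of `a i` moves `c` into `I_n` without changing its class modulo `a i`.
        have hd : c - d * a i ∈ S.kerIdeal n := by
          rw [RingHom.mem_ker, map_sub, map_mul, hb, sub_self]
        have : Pi.single i (e x i) = (c - d * a i) •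
            (Pi.single i 1 : ∀ i, S.Lim ⧸ Ideal.span {a i}) := by
          rw [← Pi.single_smul, ← hc]
          congr 1
          rw [Algebra.smul_def, mul_one, Ideal.Quotient.algebraMap_eq, Ideal.Quotient.eq,
            sub_sub_cancel]
          exact Ideal.mul_mem_left _ _ (Ideal.mem_span_singleton_self _)
        rw [this]
        exact Submodule.smul_mem_smul hd trivial
      have := Submodule.mem_map_of_mem (f := e.symm.toLinearMap) hmem
      rw [Submodule.map_smul''] at this
      exact Submodule.smul_mono le_rfl le_top (by simpa using this)
  let E : S.Level M n ≃ₗ[S.Lim] ∀ i, S.obj n ⧸ Ideal.span {S.proj n (a i)} :=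
    (Submodule.quotEquivOfEq _ _ hker).trans (T.quotKerEquivOfSurjective hT)
  -- Linearity over `A` is linearity over `A_n`, because `A` acts on both sides through its
  -- surjection onto `A_n`.
  refine ⟨{ E.toAddEquiv with map_smul' := fun r x => ?_ }⟩
  obtain ⟨c, rfl⟩ := S.proj_surjective n r
  change E (S.proj n c • x) = algebraMap S.Lim (S.obj n) c • E x
  rw [S.proj_smul, map_smul, algebraMap_smul]

theorem exists_forall_proj_ne_zero {a : S.Lim} (ha : a ≠ 0) :
    ∃ N, ∀ n, N ≤ n → S.proj n a ≠ 0 := by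
  by_contra! h
  refine ha (S.ext_proj fun n => ?_)
  obtain ⟨m, hm, h0⟩ := h n
  exact (antitone_nat_of_succ_le S.kerIdeal_succ_le hm h0 : S.proj n a = 0).trans
    (map_zero _).symm

end RingTower

end

theorem mainTheorem5 (S : RingTower.{u})
    [∀ n, TopologicalSpace (S.obj n)] [∀ n, IsTopologicalRing (S.obj n)]
    [∀ n, CompactSpace (S.obj n)] [∀ n, T2Space (S.obj n)]
    (hcont : ∀ n, Continuous (S.map n))
    (M : Type v) [AddCommGroup M] [Module S.Lim M] [Module.FinitePresentation S.Lim M] :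
    S.IsLevelComplete M ∧
    (IsSemisimpleRing (FractionRing S.Lim) → IsAmenableModule S.Lim M →
      Module.IsTorsion S.Lim M →
      (∃! J, IsCharIdeal S.Lim M J) ∧
      charIdeal S.Lim M =
        S.limIdeal 0 fun n => (charIdeal S.Lim M).map (S.proj n)) ∧
    (IsDomain S.Lim → UniqueFactorizationMonoid S.Lim →
      (∀ n, IsDomain (S.obj n)) → (∀ n, UniqueFactorizationMonoid (S.obj n)) →
      Module.IsTorsion S.Lim M →
      IsAmenableModule S.Lim M ∧ (∃! J, IsCharIdeal S.Lim M J) ∧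
      ∃ (M' : Type u) (_ : AddCommGroup M') (_ : Module S.Lim M') (f : M →ₗ[S.Lim] M'),
        IsPseudoIso f ∧ Module.FinitePresentation S.Lim M' ∧ Module.IsTorsion S.Lim M' ∧
        S.IsLevelComplete M' ∧
        ∃ N : ℕ,
          (∀ n, N ≤ n →
            Module.FinitePresentation (S.obj n) (S.Level M' n) ∧
            Module.IsTorsion (S.obj n) (S.Level M' n) ∧
            IsAmenableModule (S.obj n) (S.Level M' n) ∧
            (∃! J, IsCharIdeal (S.obj n) (S.Level M' n) J) ∧
            (charIdeal (S.obj (n + 1)) (S.Level M' (n + 1))).map (S.map n) ≤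
              charIdeal (S.obj n) (S.Level M' n)) ∧
          charIdeal S.Lim M =
            S.limIdeal N fun n => charIdeal (S.obj n) (S.Level M' n)) := by
  refine ⟨S.isLevelComplete hcont M, fun hss ham htor => ?_, fun _ _ _ _ htor => ?_⟩
  · have huniq := ham.existsUnique_isCharIdeal hss htor
    exact ⟨huniq, S.eq_limIdeal_of_fg hcont
      (ham.fg_of_isCharIdeal (isCharIdeal_charIdeal huniq.exists)) 0 _ fun _ _ => rfl⟩
  have ham := isAmenableModule_of_isTorsion M htor
  -- The total quotient ring of a domain is a field, hence semisimple.
  have huniq := ham.existsUnique_isCharIdeal inferInstance htor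
  have hchar := isCharIdeal_charIdeal huniq.exists
  refine ⟨ham, huniq, ?_⟩
  have := ham.finite_primes.to_subtype
  cases nonempty_fintype (torsionHeightOnePrimes S.Lim M)
  obtain ⟨k, e, f, hf, -⟩ := id hchar
  obtain ⟨a, ha, ⟨E⟩⟩ := exists_primePowerSum_equiv M k e
  have hprod : ∏ x, a x ≠ 0 := Finset.prod_ne_zero_iff.2 fun x _ => ha x
  have := finitePresentation_pi_quotient_span a
  have : Module.FinitePresentation S.Lim (PrimePowerSum S.Lim M k e) := .of_equiv E.symm
  have hJ : charIdeal S.Lim M = Ideal.span {∏ x, a x} :=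
    hchar.eq_span htor hprod _ (IsPseudoIso.linearEquiv_comp hf E)
  -- From this `N` on, every `a x` stays nonzero in the domain `A_n`, which is what keeps the
  -- reduced module torsion.
  obtain ⟨N, hN⟩ := S.exists_forall_proj_ne_zero hprod
  have key : ∀ n, N ≤ n →
      Module.FinitePresentation (S.obj n) (S.Level (PrimePowerSum S.Lim M k e) n) ∧
      Module.IsTorsion (S.obj n) (S.Level (PrimePowerSum S.Lim M k e) n) ∧
      IsAmenableModule (S.obj n) (S.Level (PrimePowerSum S.Lim M k e) n) ∧
      (∃! J, IsCharIdeal (S.obj n) (S.Level (PrimePowerSum S.Lim M k e) n) J) ∧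
      charIdeal (S.obj n) (S.Level (PrimePowerSum S.Lim M k e) n) =
        (charIdeal S.Lim M).map (S.proj n) := by
    intro n hn
    obtain ⟨En⟩ := S.exists_level_linearEquiv E n
    have := finitePresentation_pi_quotient_span fun x => S.proj n (a x)
    have hfp : Module.FinitePresentation (S.obj n) (S.Level (PrimePowerSum S.Lim M k e) n) :=
      .of_equiv En.symm
    have hprod' : ∏ x, S.proj n (a x) ≠ 0 := by
      rw [← map_prod]
      exact hN n hn
    have ht := Module.IsTorsion.of_linearEquiv En (isTorsion_pi_quotient_span hprod')
    have ham' := isAmenableModule_of_isTorsion _ ht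
    have hu := ham'.existsUnique_isCharIdeal inferInstance ht
    refine ⟨hfp, ht, ham', hu, ?_⟩
    -- At level `n` the module is already isomorphic to a product of cyclic modules, so its
    -- characteristic ideal is generated by the image of `∏ a x`.
    rw [(isCharIdeal_charIdeal hu.exists).eq_span ht hprod' _
      (IsPseudoIso.linearEquiv_comp isPseudoIso_id En), hJ, Ideal.map_span, Set.image_singleton,
      map_prod]
  refine ⟨PrimePowerSum S.Lim M k e, inferInstance, inferInstance, f, hf, this,
    .of_linearEquiv E (isTorsion_pi_quotient_span hprod), S.isLevelComplete hcont _, N,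
    fun n hn => ?_, ?_⟩
  · obtain ⟨h1, h2, h3, h4, h5⟩ := key n hn
    refine ⟨h1, h2, h3, h4, ?_⟩
    rw [(key (n + 1) (hn.trans n.le_succ)).2.2.2.2, h5, S.map_map_proj]
  · exact S.eq_limIdeal_of_fg hcont (hJ ▸ Submodule.fg_span_singleton _) N _
      fun n hn => (key n hn).2.2.2.2
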